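/- **Setting.** Let $\mathscr{S}$ be an essentially small triangulated category with shift $[1]$. For an object $G$ of a triangulated category and $I\subseteq\mathbb{Z}$ put $G(I)=\{G[-i]\mid i\in I\}$, and let $\langle G\rangle^{I}$ be the smallest full subcategory containing $G(I)$ and closed under extensions and direct summands. The *finitistic dimension* of $\mathscr{S}$ at $G$ is $$\mathrm{findim}(\mathscr{S},G)=\inf\{n\in\mathbb{N}\mid G((-\infty,-1])^{\perp}\subseteq\langle G\rangle^{[0,\infty)}[n]\}\in\mathbb{N}\cup\{\infty\}.$$ A *good metric* on $\mathscr{S}$ is a sequence $\mathscr{M}=\{\mathscr{M}_n\}_{n\in\mathbb{N}}$ of full subcategories containing $0$ and closed under extensions with $\mathscr{M}_{n+1}[-1]\cup\mathscr{M}_{n+1}\cup\mathscr{M}_{n+1}[1]\subseteq\mathscr{M}_n$ for all $n$. Two good metrics $\mathscr{M},\mathscr{N}$ are *equivalent* if every $\mathscr{N}_n$ contains some $\mathscr{M}_m$ and every $\mathscr{M}_n$ contains some $\mathscr{N}_m$; $\mathscr{M}$ is *$G$-good* if it is equivalent to $\{\langle G\rangle^{(-\infty,-n]}\}_{n\in\mathbb{N}}$.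 Let $\mathscr{S}\text{-Mod}$ be the category of additive functors from $\mathscr{S}^{\mathrm{op}}$ to abelian groups, with automorphisms $(\Sigma^nF)(X)=F(X[-n])$, and identify $\mathscr{S}$ with its essential image in $\mathscr{S}\text{-Mod}$ under the Yoneda functor $\mathfrak{y}$. A sequence $X_0\to X_1\to\cdots$ in $\mathscr{S}$ is *Cauchy* with respect to $\mathscr{M}$ if for every $i$ the cones of all but finitely many of the maps $X_j\to X_{j+1}$ lie in $\mathscr{M}_i$. The *completion* of $\mathscr{S}$ with respect to $\mathscr{M}$ is the full subcategory of $\mathscr{S}\text{-Mod}$ of all functors $F$ such that $F\cong\mathrm{colim}\,\mathfrak{y}(X_n)$ for a Cauchy sequence $\{X_n\}$ and $F(\mathscr{M}_j)=0$ for some $j$. It is a triangulated category with shift $\Sigma$; its distinguished triangles are the sequences $A\to B\to C\to\Sigma A$ in it which are isomorphic to the colimit of the image under $\mathfrak{y}$ of a sequence of distinguished triangles of $\mathscr{S}$ whose three sequences of vertices are Cauchy. The completion $\mathfrak{S}_G(\mathscr{S})$ at $G$ is the completion with respect to any $G$-good metric. A t-structure $(\mathscr{X}^{\leqslant 0},\mathscr{X}^{\geqslant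 0})$ on a triangulated category $\mathscr{X}$, with $\mathscr{X}^{\leqslant n}=\mathscr{X}^{\leqslant 0}[-n]$ and $\mathscr{X}^{\geqslant n}=\mathscr{X}^{\geqslant 0}[-n]$, is *bounded* if every object lies in $\mathscr{X}^{\leqslant n}\cap\mathscr{X}^{\geqslant -n}$ for some $n\in\mathbb{N}$. Two t-structures on $\mathscr{X}$ are *equivalent* if $\mathscr{X}_1^{\leqslant -n}\subseteq\mathscr{X}_2^{\leqslant 0}\subseteq\mathscr{X}_1^{\leqslant n}$ for some $n\in\mathbb{N}$. **Theorem.** Let $\mathscr{S}$ be an essentially small triangulated category and $G$ an object of $\mathscr{S}$ with $\mathrm{findim}(\mathscr{S}^{\mathrm{op}},G^{\mathrm{op}})<\infty$. (a) If $\mathscr{S}$ has a bounded t-structure, then $\mathscr{S}=\mathfrak{S}_G(\mathscr{S})$ as full subcategories of $\mathscr{S}\text{-Mod}$. (b) If $\mathscr{X}$ is a full triangulated subcategory of $\mathfrak{S}_G(\mathscr{S})$ (closed under isomorphisms) with $\mathscr{S}\subseteq\mathscr{X}$, then all bounded t-structures on $\mathscr{X}$ are equivalent. In particular, if $\mathscr{S}\subseteq\mathfrak{S}_G(\mathscr{S})$,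 then all bounded t-structures on $\mathfrak{S}_G(\mathscr{S})$ are equivalent. -/

import Mathlib

open CategoryTheory Limits Pretriangulated Triangulated Pretriangulated.Opposite Opposite

universe w v u

namespace TriangulatedCompletion

section Generation

variable {C : Type u} [Category.{v} C] [Preadditive C] [HasZeroObject C] [HasShift C ℤ]
  [∀ n : ℤ, (shiftFunctor C n).Additive] [Pretriangulated C]

/-- The class `{G[-i] | i ∈ I}` of shifts of `G`, for a set `I` of integers. -/
def shiftsIn (G : C) (I : Set ℤ) : ObjectProperty C :=
  ObjectProperty.ofObj (fun i : I => G⟦-(i : ℤ)⟧)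

/-- The smallest full subcategory of `C` which contains the objects in `P` and is closed under
extensions and direct summands (hence also under isomorphisms). In a triangulated category the
direct summands of an object are exactly its retracts. -/
inductive extSummandClosure (P : ObjectProperty C) : ObjectProperty C
  | of (X : C) (hX : P X) : extSummandClosure P X
  | ext (T : Triangle C) (hT : T ∈ distTriang C) (h₁ : extSummandClosure P T.obj₁)
      (h₃ : extSummandClosure P T.obj₃) : extSummandClosure P T.obj₂
  | summand (X Y : C) (r : Retract X Y) (hY : extSummandClosure P Y) : extSummandClosure P X

/-- The subcategory `⟨G⟩^I` generated by the objects `G[-i]`, `i ∈ I`, under extensions and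
direct summands. For `I = (-∞, n]` it is automatically closed under positive shifts, for
`I = [n, ∞)` under negative shifts. -/
abbrev generated (G : C) (I : Set ℤ) : ObjectProperty C :=
  extSummandClosure (shiftsIn G I)

/-- The finitistic dimension of `C` at `G`: the infimum of the natural numbers `n` such that
`G(-∞, -1]^⊥ ⊆ ⟨G⟩^[0, ∞)[n]`. An object `Y` lies in `P[n]` if and only if `Y[-n]` lies in `P`. -/
noncomputable def findim (G : C) : ℕ∞ :=
  ⨅ (n : ℕ) (_ : ∀ Y : C, (shiftsIn G (Set.Iic (-1))).rightOrthogonal Y →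
    generated G (Set.Ici 0) (Y⟦-(n : ℤ)⟧)), (n : ℕ∞)

lemma extSummandClosure_shift {P Q : ObjectProperty C} (a : ℤ)
    (h : ∀ X, P X → extSummandClosure Q (X⟦a⟧)) {X : C} (hX : extSummandClosure P X) :
    extSummandClosure Q (X⟦a⟧) := by
  induction hX with
  | of X hX => exact h X hX
  | ext T hT _ _ h₁ h₃ => exact .ext _ (Triangle.shift_distinguished T hT a) h₁ h₃
  | summand X Y r _ hY => exact .summand _ _ (r.map (shiftFunctor C a)) hY

lemma generated_shift (G : C) (a : ℤ) {I J : Set ℤ} (hIJ : ∀ i ∈ I, i - a ∈ J) {X : C}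
    (hX : generated G I X) : generated G J (X⟦a⟧) := by
  refine extSummandClosure_shift a ?_ hX
  rintro _ ⟨⟨i, hi⟩⟩
  exact .summand _ _ (Retract.ofIso ((shiftFunctorAdd' C (-i) a (-(i - a)) (by lia)).symm.app G))
    (.of _ (ObjectProperty.ofObj_apply (fun i : J => G⟦-(i : ℤ)⟧) ⟨i - a, hIJ i hi⟩))

lemma generated_mono (G : C) {I J : Set ℤ} (hIJ : I ⊆ J) {X : C}
    (hX : generated G I X) : generated G J X := by
  induction hX with
  | of X hX =>
    obtain ⟨⟨i, hi⟩⟩ := hX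
    exact .of _ (ObjectProperty.ofObj_apply (fun i : J => G⟦-(i : ℤ)⟧) ⟨i, hIJ hi⟩)
  | ext T hT _ _ h₁ h₃ => exact .ext _ hT h₁ h₃
  | summand X Y r _ hY => exact .summand _ _ r hY

end Generation

section Modules

variable (S : Type u) [Category.{v} S] [Preadditive S]

/-- The category `S-Mod` of additive functors from `Sᵒᵖ` to abelian groups. -/
abbrev SMod := Sᵒᵖ ⥤+ AddCommGrpCat.{v}

/-- The Yoneda functor `X ↦ Hom_S(-, X)` with values in `S-Mod`. -/
abbrev yonedaMod : S ⥤ SMod S :=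
  ObjectProperty.lift _ preadditiveYoneda (fun X => additive_yonedaObj' X)

variable [HasShift S ℤ] [∀ n : ℤ, (shiftFunctor S n).Additive]

/-- The functor `Σ^n` on `S-Mod`, given by `(Σ^n F)(X) = F(X[-n])`. -/
abbrev modShift (n : ℤ) : SMod S ⥤ SMod S :=
  ObjectProperty.lift _
    (ObjectProperty.ι _ ⋙ (Functor.whiskeringLeft _ _ _).obj (shiftFunctor S (-n)).op)
    (fun F => (inferInstance : ((shiftFunctor S (-n)).op ⋙ F.obj).Additive))

variable {S}

/-- The canonical isomorphism `Hom(-, X[1]) ≅ Σ Hom(-, X)`, as a morphism: on an object `Y` it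
sends `f : Y ⟶ X[1]` to `f[-1] : Y[-1] ⟶ X[1][-1] ≅ X`. -/
def yonedaShift (X : S) :
    (yonedaMod S).obj (X⟦(1 : ℤ)⟧) ⟶ (modShift S 1).obj ((yonedaMod S).obj X) :=
  ObjectProperty.homMk
    { app := fun Y => AddCommGrpCat.ofHom
        (AddMonoidHom.mk' (fun f : Y.unop ⟶ X⟦(1 : ℤ)⟧ =>
            (shiftFunctor S (-1 : ℤ)).map f ≫
              (shiftFunctorCompIsoId S (1 : ℤ) (-1) (by lia)).hom.app X)
          (fun f g => (congrArg (· ≫ _) ((shiftFunctor S (-1 : ℤ)).map_add (f := f) (g := g))).trans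
            (Preadditive.add_comp _ _ _ _ _ _)))
      naturality := fun Y Z h => by
        ext f
        exact (congrArg (· ≫ _) ((shiftFunctor S (-1 : ℤ)).map_comp h.unop f)).trans
          (Category.assoc _ _ _) }

end Modules

variable (S : Type u) [Category.{v} S] [Preadditive S] [HasZeroObject S] [HasShift S ℤ]
  [∀ n : ℤ, (shiftFunctor S n).Additive] [Pretriangulated S]

/-- A good metric on `S`: a sequence of full subcategories containing zero and closed under
extensions, such that `M_{n+1}[-1]`, `M_{n+1}` and `M_{n+1}[1]` are contained in `M_n`. (Closure
under isomorphisms follows from closure under extensions with a zero object.) -/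
structure GoodMetric where
  /-- the `n`-th subcategory of the metric -/
  ball (n : ℕ) : ObjectProperty S
  containsZero (n : ℕ) : (ball n).ContainsZero
  extension (n : ℕ) (T : Triangle S) (hT : T ∈ distTriang S) :
    ball n T.obj₁ → ball n T.obj₃ → ball n T.obj₂
  shift_neg (n : ℕ) (X : S) : ball (n + 1) X → ball n (X⟦(-1 : ℤ)⟧)
  antitone (n : ℕ) (X : S) : ball (n + 1) X → ball n X
  shift_pos (n : ℕ) (X : S) : ball (n + 1) X → ball n (X⟦(1 : ℤ)⟧)

variable {S}

namespace GoodMetric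

/-- `M` is finer than `N`. -/
def Finer (M N : GoodMetric S) : Prop :=
  ∀ n, ∃ m, M.ball m ≤ N.ball n

/-- Equivalence of good metrics. -/
def Equivalent (M N : GoodMetric S) : Prop :=
  M.Finer N ∧ N.Finer M

/-- The good metric `{⟨G⟩^(-∞, -n]}_n` generated by an object `G`. -/
def ofObject (G : S) : GoodMetric S where
  ball n := generated G (Set.Iic (-(n : ℤ)))
  containsZero n := ⟨⟨_, isZero_zero S,
    .summand _ _ { i := 0, r := 0, retract := (isZero_zero S).eq_of_src _ _ }
      (.of _ (ObjectProperty.ofObj_apply (fun i : Set.Iic (-(n : ℤ)) => G⟦-(i : ℤ)⟧)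
        ⟨-(n : ℤ), Set.mem_Iic.2 le_rfl⟩))⟩⟩
  extension n T hT h₁ h₃ := .ext T hT h₁ h₃
  shift_neg n X hX := generated_shift G (-1) (fun i hi => by
    simp only [Set.mem_Iic, Nat.cast_add, Nat.cast_one] at hi ⊢; lia) hX
  antitone n X hX := generated_mono G (fun i hi => by
    simp only [Set.mem_Iic, Nat.cast_add, Nat.cast_one] at hi ⊢; lia) hX
  shift_pos n X hX := generated_shift G 1 (fun i hi => by
    simp only [Set.mem_Iic, Nat.cast_add, Nat.cast_one] at hi ⊢; lia) hX

/-- A `G`-good metric is a good metric equivalent to the one generated by `G`. -/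
def IsGood (M : GoodMetric S) (G : S) : Prop :=
  M.Equivalent (ofObject G)

variable (M : GoodMetric S)

/-- A sequence `X₀ ⟶ X₁ ⟶ X₂ ⟶ ⋯` in `S` is Cauchy if for every `i` the cones of all but finitely
many of its maps `X_j ⟶ X_{j+1}` lie in `M_i`. (`P.trW f` says that the cone of `f` lies
in `P`.) -/
def IsCauchy (X : ℕ ⥤ S) : Prop :=
  ∀ i : ℕ, ∃ N : ℕ, ∀ j ≥ N, (M.ball i).trW (X.map (homOfLE (Nat.le_succ j)))

/-- `𝔏(S)`: the colimits in `S-Mod` of the images under Yoneda of Cauchy sequences in `S`. -/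
def cauchyColimits : ObjectProperty (SMod S) := fun F =>
  ∃ X : ℕ ⥤ S, M.IsCauchy X ∧
    ∃ a : X ⋙ yonedaMod S ⟶ (Functor.const ℕ).obj F, Nonempty (IsColimit (Cocone.mk F a))

/-- `ℭ(S)`: the functors in `S-Mod` which vanish on some `M_j`. -/
def compactlySupported : ObjectProperty (SMod S) := fun F =>
  ∃ j : ℕ, ∀ X : S, M.ball j X → IsZero (F.obj.obj (op X))

/-- The completion `𝔖(S) = 𝔏(S) ∩ ℭ(S)` of `S`, a full subcategory of `S-Mod`. -/
def completion : ObjectProperty (SMod S) :=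
  M.cauchyColimits ⊓ M.compactlySupported

/-- The distinguished triangles `A ⟶ B ⟶ C ⟶ ΣA` of `𝔖(S)`: the sequences in `𝔖(S)` which are
colimits of the images under Yoneda of Cauchy sequences of distinguished triangles of `S`. The
natural transformations `a`, `b`, `c` exhibit `A`, `B`, `C` as the colimits of the three sequences
of vertices, and the last three equations say that `α`, `β`, `γ` are the maps induced on the
colimits. -/
def IsDistinguished {A B C : SMod S} (α : A ⟶ B) (β : B ⟶ C)
    (γ : C ⟶ (modShift S 1).obj A) : Prop :=
  M.completion A ∧ M.completion B ∧ M.completion C ∧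
  ∃ T : ℕ ⥤ Triangle S, (∀ n, T.obj n ∈ distTriang S) ∧
    M.IsCauchy (T ⋙ Triangle.π₁) ∧ M.IsCauchy (T ⋙ Triangle.π₂) ∧
    M.IsCauchy (T ⋙ Triangle.π₃) ∧
    ∃ (a : (T ⋙ Triangle.π₁) ⋙ yonedaMod S ⟶ (Functor.const ℕ).obj A)
      (b : (T ⋙ Triangle.π₂) ⋙ yonedaMod S ⟶ (Functor.const ℕ).obj B)
      (c : (T ⋙ Triangle.π₃) ⋙ yonedaMod S ⟶ (Functor.const ℕ).obj C),
      Nonempty (IsColimit (Cocone.mk A a)) ∧ Nonempty (IsColimit (Cocone.mk B b)) ∧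
      Nonempty (IsColimit (Cocone.mk C c)) ∧
      (∀ n, a.app n ≫ α = (yonedaMod S).map (T.obj n).mor₁ ≫ b.app n) ∧
      (∀ n, b.app n ≫ β = (yonedaMod S).map (T.obj n).mor₂ ≫ c.app n) ∧
      (∀ n, c.app n ≫ γ = (yonedaMod S).map (T.obj n).mor₃ ≫
        yonedaShift (T.obj n).obj₁ ≫ (modShift S 1).map (a.app n))

/-- `X` is a (strictly) full triangulated subcategory of `𝔖(S)`: it contains zero and is closed
under isomorphisms, all shifts, and cones. -/
structure IsTriangulatedSubcategory (X : ObjectProperty (SMod S)) : Prop where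
  le_completion : X ≤ M.completion
  closedUnderIso : X.IsClosedUnderIsomorphisms
  containsZero : X.ContainsZero
  shift (n : ℤ) (F : SMod S) : X F → X ((modShift S n).obj F)
  cone {A B C : SMod S} (α : A ⟶ B) (β : B ⟶ C) (γ : C ⟶ (modShift S 1).obj A) :
    M.IsDistinguished α β γ → X A → X B → X C

/-- A t-structure `(X^{≤ 0}, X^{≥ 0})` on a full triangulated subcategory `X` of `𝔖(S)`, whose
distinguished triangles are those of `𝔖(S)` with all vertices in `X`. An object `F` lies in
`X^{≤ n} = X^{≤ 0}[-n]` if and only if `Σ^n F` lies in `X^{≤ 0}`, and similarly for `X^{≥ n}`. -/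
structure TStructureOn (X : ObjectProperty (SMod S)) where
  /-- the aisle `X^{≤ 0}` -/
  aisle : ObjectProperty (SMod S)
  /-- the coaisle `X^{≥ 0}` -/
  coaisle : ObjectProperty (SMod S)
  aisle_le : aisle ≤ X
  coaisle_le : coaisle ≤ X
  aisle_closedUnderIso : aisle.IsClosedUnderIsomorphisms
  coaisle_closedUnderIso : coaisle.IsClosedUnderIsomorphisms
  aisle_shift (F : SMod S) : aisle ((modShift S (-1)).obj F) → aisle F
  coaisle_shift (F : SMod S) : coaisle F → coaisle ((modShift S (-1)).obj F)
  hom_eq_zero {F F' : SMod S} (f : F ⟶ F') :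
    aisle ((modShift S (-1)).obj F) → coaisle F' → f = 0
  exists_triangle (F : SMod S) (hF : X F) :
    ∃ (A B : SMod S) (α : A ⟶ F) (β : F ⟶ B) (γ : B ⟶ (modShift S 1).obj A),
      X A ∧ aisle ((modShift S (-1)).obj A) ∧ coaisle B ∧ M.IsDistinguished α β γ

namespace TStructureOn

variable {M} {X : ObjectProperty (SMod S)}

/-- The t-structure is bounded: every object of `X` lies in some `X^{≤ n}` and in some
`X^{≥ -n}`. -/
def IsBounded (t : M.TStructureOn X) : Prop :=
  ∀ F : SMod S, X F → (∃ n : ℕ, t.aisle ((modShift S n).obj F)) ∧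
    ∃ n : ℕ, t.coaisle ((modShift S (-n)).obj F)

/-- Equivalence of t-structures: `X₁^{≤ -n} ⊆ X₂^{≤ 0} ⊆ X₁^{≤ n}` for some natural
number `n`. -/
def Equivalent (t₁ t₂ : M.TStructureOn X) : Prop :=
  ∃ n : ℕ, (∀ F : SMod S, t₁.aisle ((modShift S (-n)).obj F) → t₂.aisle F) ∧
    ∀ F : SMod S, t₂.aisle F → t₁.aisle ((modShift S n).obj F)

end TStructureOn

end GoodMetric

end TriangulatedCompletion

namespace TriangulatedCompletion

/-! ### The additive Yoneda lemma and sequential colimits in `SMod S` -/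

section Modules

variable {S : Type u} [Category.{v} S] [Preadditive S]

/-! Finiteness of the finitistic dimension of the opposite category says that, for some `n₀`, an
object of `S` without nonzero maps to `G⟦i⟧` for all `i < 0` lies in `⟨G⟩^(-∞, n₀]`. Orthogonality
to shifts of `G` is thus converted into generation by `G`, hence into smallness for the metric.

A morphism out of a term of a Cauchy sequence into a cohomological functor `D` extends to the
colimit as soon as `D` kills the later cones shifted by `-1`, and it does so in at most one way if
`D` kills the cones themselves (`exists_extend_colimit`, `eq_zero_of_colimit`).

For (a), boundedness bounds `G` on both sides. The upper bound makes representables compactly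
supported. The lower bound, with `n₀`, makes every `F` in the completion vanish on some `t.le d`.
Truncate a far term of a Cauchy sequence for `F` at `d`: the part in degrees at most `d` is
invisible to `F`, and the part above is isomorphic to `F` (`essImage_of_exists_truncation`).

For (b), shift `F` in the first aisle until it has no maps to `G⟦i⟧` for `i` below a large bound.
The far terms of a Cauchy sequence for it inherit this, so they are generated by very connective
shifts of `G` (`GoodMetric.exists_generated_of_colimit`). These have no maps to the second coaisle,
so neither has the colimit, which therefore lies in the second aisle (`aisle_of_hom_eq_zero`). By
symmetry the t-structures are equivalent. -/

instance additiveFunctor_isClosedUnderColimitsOfShape {A : Type*} [Category* A] [Preadditive A]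
    (J : Type*) [Category* J] [HasColimitsOfShape J A] :
    (additiveFunctor S A).IsClosedUnderColimitsOfShape J where
  colimitsOfShape_le := by
    rintro F ⟨p⟩
    refine ⟨fun {Y Z f g} => ?_⟩
    refine (isColimitOfPreserves ((evaluation S A).obj Y) p.isColimit).hom_ext (fun j => ?_)
    have h (h : Y ⟶ Z) : (p.ι.app j).app Y ≫ F.map h = (p.diag.obj j).map h ≫ (p.ι.app j).app Z :=
      ((p.ι.app j).naturality h).symm
    have : (p.diag.obj j).Additive := p.prop_diag_obj j
    change (p.ι.app j).app Y ≫ F.map (f + g) = (p.ι.app j).app Y ≫ (F.map f + F.map g)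
    rw [Preadditive.comp_add, h, h, h, Functor.map_add, Preadditive.add_comp]

/-- The additive Yoneda lemma. -/
def yonedaModEquiv (Z : S) (F : SMod S) :
    ((yonedaMod S).obj Z ⟶ F) ≃ F.obj.obj (op Z) where
  toFun f := f.hom.app (op Z) (𝟙 Z)
  invFun x := ObjectProperty.homMk
    { app := fun Y => AddCommGrpCat.ofHom
        (AddMonoidHom.mk' (fun f : Y.unop ⟶ Z => F.obj.map f.op x)
          (fun f g => by
            have h := F.obj.map_add (f := Quiver.Hom.op (show Y.unop ⟶ Z from f))
              (g := Quiver.Hom.op (show Y.unop ⟶ Z from g))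
            exact ConcreteCategory.congr_hom h x))
      naturality := fun Y Y' h => by
        ext f
        exact (ConcreteCategory.congr_hom (F.obj.map_comp (Quiver.Hom.op f) h) x) }
  left_inv f := by
    ext Y g
    have := ConcreteCategory.congr_hom (f.hom.naturality (Quiver.Hom.op g)) (𝟙 Z)
    refine this.symm.trans ?_
    exact congrArg (f.hom.app Y) (Category.comp_id (g : Y.unop ⟶ Z))
  right_inv x := ConcreteCategory.congr_hom (F.obj.map_id (op Z)) x

lemma yonedaModEquiv_comp {Z : S} {F F' : SMod S} (f : (yonedaMod S).obj Z ⟶ F) (α : F ⟶ F') :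
    yonedaModEquiv Z F' (f ≫ α) = α.hom.app (op Z) (yonedaModEquiv Z F f) := rfl

lemma yonedaModEquiv_naturality {Z Z' : S} {F : SMod S} (g : Z' ⟶ Z)
    (f : (yonedaMod S).obj Z ⟶ F) :
    yonedaModEquiv Z' F ((yonedaMod S).map g ≫ f) = F.obj.map g.op (yonedaModEquiv Z F f) := by
  refine (congrArg (f.hom.app (op Z')) ?_).trans
    (ConcreteCategory.congr_hom (f.hom.naturality g.op) (𝟙 Z))
  exact (Category.id_comp g).trans (Category.comp_id g).symm

instance : (yonedaMod S).Additive where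
  map_add {X Y f g} := by
    ext Z h
    exact Preadditive.comp_add _ _ _ h f g

instance : (yonedaMod S).Full where
  map_surjective {X Y} f :=
    ⟨preadditiveYoneda.preimage f.hom, by ext : 1; exact preadditiveYoneda.map_preimage f.hom⟩

instance : (yonedaMod S).Faithful where
  map_injective {X Y _ _} h := preadditiveYoneda.map_injective
    (congrArg (fun k : (yonedaMod S).obj X ⟶ (yonedaMod S).obj Y => k.hom) h)

lemma isIso_of_bijective_yonedaMod {F F' : SMod S} (α : F ⟶ F')
    (hα : ∀ Z : S, Function.Bijective (fun f : (yonedaMod S).obj Z ⟶ F => f ≫ α)) :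
    IsIso α := by
  have (Z : Sᵒᵖ) : IsIso (α.hom.app Z) := by
    rw [ConcreteCategory.isIso_iff_bijective]
    have h := ((yonedaModEquiv Z.unop F').bijective.comp (hα Z.unop)).comp
      (yonedaModEquiv Z.unop F).symm.bijective
    convert h using 1
    ext x
    obtain ⟨f, rfl⟩ := (yonedaModEquiv Z.unop F).surjective x
    change _ = yonedaModEquiv _ _ ((yonedaModEquiv _ _).symm (yonedaModEquiv _ _ f) ≫ α)
    rw [Equiv.symm_apply_apply]
    rfl
  have : IsIso α.hom := NatIso.isIso_of_isIso_app _
  exact (ObjectProperty.isIso_hom_iff _).1 this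

instance : PreservesColimitsOfShape ℕ (forget AddCommGrpCat.{v}) :=
  have : PreservesFilteredColimitsOfSize.{0, 0} (forget AddCommGrpCat.{v}) :=
    preservesFilteredColimitsOfSize_shrink.{0, v, 0, v} _
  PreservesFilteredColimitsOfSize.preserves_filtered_colimits ℕ

/-- Representables are compact for sequences: additive functors are closed under colimits, so
colimits are pointwise, and sequential colimits of abelian groups are computed on underlying sets.
-/
lemma exists_factor_of_isColimit {K : ℕ ⥤ SMod S} {c : Cocone K} (hc : IsColimit c) {Z : S}
    (f : (yonedaMod S).obj Z ⟶ c.pt) :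
    ∃ (n : ℕ) (g : (yonedaMod S).obj Z ⟶ K.obj n), g ≫ c.ι.app n = f := by
  have hc' := isColimitOfPreserves
    (ObjectProperty.ι _ ⋙ (evaluation Sᵒᵖ AddCommGrpCat.{v}).obj (op Z)) hc
  obtain ⟨n, x, hx⟩ := Concrete.isColimit_exists_rep _ hc' (yonedaModEquiv Z _ f)
  refine ⟨n, (yonedaModEquiv Z _).symm x, (yonedaModEquiv Z _).injective ?_⟩
  rw [yonedaModEquiv_comp, Equiv.apply_symm_apply]
  exact hx

lemma exists_map_eq_zero_of_isColimit {K : ℕ ⥤ SMod S} {c : Cocone K} (hc : IsColimit c) {Z : S}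
    {n : ℕ} (g : (yonedaMod S).obj Z ⟶ K.obj n) (hg : g ≫ c.ι.app n = 0) :
    ∃ (m : ℕ) (h : n ⟶ m), g ≫ K.map h = 0 := by
  have hc' := isColimitOfPreserves
    (ObjectProperty.ι _ ⋙ (evaluation Sᵒᵖ AddCommGrpCat.{v}).obj (op Z)) hc
  obtain ⟨m, h, h', hx⟩ := Concrete.isColimit_exists_of_rep_eq _ hc'
    (yonedaModEquiv Z _ g) (yonedaModEquiv Z _ (0 : (yonedaMod S).obj Z ⟶ K.obj n)) (by
      change (c.ι.app n).hom.app (op Z) _ = (c.ι.app n).hom.app (op Z) _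
      rw [← yonedaModEquiv_comp, ← yonedaModEquiv_comp, hg, zero_comp])
  refine ⟨m, h, (yonedaModEquiv Z _).injective ?_⟩
  rw [yonedaModEquiv_comp]
  refine hx.trans ?_
  obtain rfl : h = h' := Subsingleton.elim _ _
  change (K.map h).hom.app (op Z) _ = _
  rw [← yonedaModEquiv_comp, zero_comp]

/-- A morphism from a term of a sequence extends to the colimit if it extends step by step. -/
lemma exists_extend_of_isColimit {A : Type*} [Category* A] {K : ℕ ⥤ A} {c : Cocone K}
    (hc : IsColimit c) {D : A} (N : ℕ)
    (h : ∀ n ≥ N, ∀ f : K.obj n ⟶ D, ∃ g : K.obj (n + 1) ⟶ D,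
      K.map (homOfLE (Nat.le_succ n)) ≫ g = f)
    (f : K.obj N ⟶ D) : ∃ g : c.pt ⟶ D, c.ι.app N ≫ g = f := by
  choose e he using fun k : ℕ => h (N + k) (Nat.le_add_right _ _)
  let φ (k : ℕ) : K.obj (N + k) ⟶ D := Nat.rec f (fun k g => e k g) k
  have hφ (k : ℕ) : K.map (homOfLE (Nat.le_succ (N + k))) ≫ φ (k + 1) = φ k :=
    he k _
  -- The leg at `n` passes through stage `N + n`, so that it is defined also for `n < N`.
  let s : Cocone K := Cocone.mk D (NatTrans.ofSequence
    (fun n => K.map (homOfLE (Nat.le_add_left n N)) ≫ φ n) (fun n => by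
      dsimp
      rw [← Functor.map_comp_assoc, ← hφ n, ← Functor.map_comp_assoc, Category.comp_id]
      rfl))
  refine ⟨hc.desc s, ?_⟩
  rw [hc.fac]
  change K.map (homOfLE (Nat.le_add_left N N)) ≫ φ N = f
  have (k : ℕ) : K.map (homOfLE (Nat.le_add_right N k)) ≫ φ k = f := by
    induction k with
    | zero => exact (congrArg (· ≫ f) (K.map_id N)).trans (Category.id_comp f)
    | succ k hk =>
      rw [← hk, ← hφ k, ← Functor.map_comp_assoc]
      rfl
  exact this N

lemma eq_zero_of_isColimit {A : Type*} [Category* A] [Preadditive A] {K : ℕ ⥤ A} {c : Cocone K}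
    (hc : IsColimit c) {D : A} (N : ℕ)
    (h : ∀ n ≥ N, ∀ g : K.obj (n + 1) ⟶ D, K.map (homOfLE (Nat.le_succ n)) ≫ g = 0 → g = 0)
    (g : c.pt ⟶ D) (hg : c.ι.app N ≫ g = 0) : g = 0 := by
  have key (n : ℕ) (hn : N ≤ n) : c.ι.app n ≫ g = 0 := by
    induction n, hn using Nat.le_induction with
    | base => exact hg
    | succ n hn ih =>
      exact h n hn _ (by rw [← Category.assoc, c.w, ih])
  refine hc.hom_ext (fun n => ?_)
  rw [comp_zero, ← c.w (homOfLE (Nat.le_add_left n N)), Category.assoc,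
    key _ (Nat.le_add_right N n), comp_zero]

variable {X : ℕ ⥤ S} {F : SMod S} {a : X ⋙ yonedaMod S ⟶ (Functor.const ℕ).obj F}

lemma exists_map_comp_eq (hc : IsColimit (Cocone.mk F a)) {Z : S} (f : (yonedaMod S).obj Z ⟶ F) :
    ∃ (n : ℕ) (w : Z ⟶ X.obj n), (yonedaMod S).map w ≫ a.app n = f := by
  obtain ⟨n, g, hg⟩ := exists_factor_of_isColimit hc f
  obtain ⟨w, rfl⟩ := (yonedaMod S).map_surjective g
  exact ⟨n, w, hg⟩

lemma exists_comp_map_eq_zero (hc : IsColimit (Cocone.mk F a)) {Z : S} {n : ℕ} (w : Z ⟶ X.obj n)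
    (hw : (yonedaMod S).map w ≫ a.app n = 0) : ∃ (m : ℕ) (h : n ⟶ m), w ≫ X.map h = 0 := by
  obtain ⟨m, h, hm⟩ := exists_map_eq_zero_of_isColimit hc _ hw
  exact ⟨m, h, (yonedaMod S).map_injective
    (((yonedaMod S).map_comp _ _).trans (hm.trans (Functor.map_zero _ _ _).symm))⟩

end Modules

/-! ### Cohomological functors, their vanishing loci and extension along Cauchy sequences -/

section Vanishing

variable {S : Type u} [Category.{v} S] [Preadditive S]

/-- The objects `Z` such that all morphisms from `Hom(-, Z)` to `D` vanish, i.e. `D(Z) = 0`. -/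
def vanishing (D : SMod S) : ObjectProperty S :=
  fun Z => ∀ f : (yonedaMod S).obj Z ⟶ D, f = 0

lemma vanishing_iff_isZero (D : SMod S) (Z : S) :
    vanishing D Z ↔ IsZero (D.obj.obj (op Z)) := by
  rw [AddCommGrpCat.isZero_iff_subsingleton]
  refine ⟨fun h => ⟨fun x y => ?_⟩, fun h f => (yonedaModEquiv Z D).injective (h.elim _ _)⟩
  exact (yonedaModEquiv Z D).symm.injective ((h _).trans (h _).symm)

lemma vanishing_of_retract {D : SMod S} {X Y : S} (r : Retract X Y) (hY : vanishing D Y) :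
    vanishing D X := by
  intro f
  have h := hY ((yonedaMod S).map r.r ≫ f)
  rw [← Category.id_comp f, ← (yonedaMod S).map_id, ← r.retract, Functor.map_comp,
    Category.assoc, h, comp_zero]

lemma vanishing_yonedaMod_iff (Y Z : S) :
    vanishing ((yonedaMod S).obj Y) Z ↔ ∀ f : Z ⟶ Y, f = 0 := by
  refine ⟨fun h f => (yonedaMod S).map_injective ((h _).trans (Functor.map_zero _ _ _).symm),
    fun h f => ?_⟩
  rw [← (yonedaMod S).map_preimage f, h ((yonedaMod S).preimage f), Functor.map_zero]

variable [HasZeroObject S] [HasShift S ℤ] [∀ n : ℤ, (shiftFunctor S n).Additive]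
  [Pretriangulated S]

/-- Exactness of the contravariant functor `D` on distinguished triangles. -/
def IsCohomological (D : SMod S) : Prop :=
  ∀ T ∈ distTriang S, ∀ x : (yonedaMod S).obj T.obj₂ ⟶ D, (yonedaMod S).map T.mor₁ ≫ x = 0 →
    ∃ y : (yonedaMod S).obj T.obj₃ ⟶ D, (yonedaMod S).map T.mor₂ ≫ y = x

lemma isCohomological_yonedaMod (Y : S) : IsCohomological ((yonedaMod S).obj Y) := by
  intro T hT x hx
  obtain ⟨x, rfl⟩ := (yonedaMod S).map_surjective x
  rw [← Functor.map_comp, Functor.map_eq_zero_iff] at hx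
  obtain ⟨y, rfl⟩ := Triangle.yoneda_exact₂ T hT x hx
  exact ⟨(yonedaMod S).map y, (Functor.map_comp _ _ _).symm⟩

/-- The relation `hx` already holds at a finite stage by compactness, where exactness is available.
-/
lemma isCohomological_of_isColimit {K : ℕ ⥤ SMod S} {c : Cocone K} (hc : IsColimit c)
    (hK : ∀ n, IsCohomological (K.obj n)) : IsCohomological c.pt := by
  intro T hT x hx
  obtain ⟨n, x, rfl⟩ := exists_factor_of_isColimit hc x
  rw [← Category.assoc] at hx
  obtain ⟨m, h, hm⟩ := exists_map_eq_zero_of_isColimit hc _ hx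
  rw [Category.assoc] at hm
  obtain ⟨y, hy⟩ := hK m T hT _ hm
  exact ⟨y ≫ c.ι.app m, by rw [← Category.assoc, hy, Category.assoc, c.w]⟩

/-- By the rotated triangle, the obstruction to extending `f` is its restriction to the cone shifted
by `-1`. -/
lemma IsCohomological.exists_extend {D : SMod S} (hD : IsCohomological D) {P : ObjectProperty S}
    (hP : ∀ C, P C → vanishing D (C⟦(-1 : ℤ)⟧)) {X Y : S} {g : X ⟶ Y} (hg : P.trW g)
    (f : (yonedaMod S).obj X ⟶ D) :
    ∃ f' : (yonedaMod S).obj Y ⟶ D, (yonedaMod S).map g ≫ f' = f := by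
  obtain ⟨C, a, b, hT, hC⟩ := hg
  exact hD _ (inv_rot_of_distTriang _ hT) f (hP C hC _)

lemma IsCohomological.eq_zero_of_trW {D : SMod S} (hD : IsCohomological D) {P : ObjectProperty S}
    (hP : P ≤ vanishing D) {X Y : S} {g : X ⟶ Y} (hg : P.trW g)
    (f : (yonedaMod S).obj Y ⟶ D) (hf : (yonedaMod S).map g ≫ f = 0) : f = 0 := by
  obtain ⟨C, a, b, hT, hC⟩ := hg
  obtain ⟨y, rfl⟩ := hD _ hT f hf
  exact (congrArg (_ ≫ ·) (hP C hC y)).trans comp_zero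

lemma IsCohomological.extSummandClosure_le {D : SMod S} (hD : IsCohomological D)
    {P : ObjectProperty S} (hP : P ≤ vanishing D) : extSummandClosure P ≤ vanishing D := by
  intro X hX
  induction hX with
  | of X hX => exact hP X hX
  | ext T hT _ _ h₁ h₃ =>
    intro x
    obtain ⟨y, rfl⟩ := hD T hT x (h₁ _)
    rw [h₃ y, comp_zero]
  | summand X Y r _ hY => exact vanishing_of_retract r hY

lemma trW_shift {P Q : ObjectProperty S} (a : ℤ) (h : ∀ C, P C → Q (C⟦a⟧)) {X Y : S} {f : X ⟶ Y}
    (hf : P.trW f) : Q.trW (f⟦a⟧') := by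
  -- Shifting a triangle by `a` multiplies its morphisms by the sign of `a`, which does not affect
  -- the cone.
  rw [← ObjectProperty.smul_mem_trW_iff _ _ (a.negOnePow)]
  obtain ⟨C, g, k, hT, hC⟩ := hf
  exact ⟨_, _, _, Triangle.shift_distinguished _ hT a, h _ hC⟩

lemma IsCohomological.exists_extend_modShift {D : SMod S}
    (hD : IsCohomological D) (n : ℤ) {P : ObjectProperty S}
    (hP : ∀ C, P C → vanishing D (C⟦-n⟧⟦(-1 : ℤ)⟧)) {X Y : S} {g : X ⟶ Y} (hg : P.trW g)
    (f : (yonedaMod S).obj X ⟶ (modShift S n).obj D) :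
    ∃ f' : (yonedaMod S).obj Y ⟶ (modShift S n).obj D, (yonedaMod S).map g ≫ f' = f := by
  let Q : ObjectProperty S := fun C => vanishing D (C⟦(-1 : ℤ)⟧)
  obtain ⟨f', hf'⟩ := hD.exists_extend (P := Q) (fun _ h => h) (trW_shift (Q := Q) (-n) hP hg)
    ((yonedaModEquiv _ D).symm (yonedaModEquiv X _ f))
  refine ⟨(yonedaModEquiv Y ((modShift S n).obj D)).symm (yonedaModEquiv _ D f'),
    (yonedaModEquiv _ _).injective ?_⟩
  have h := congrArg (yonedaModEquiv _ D) hf'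
  rw [yonedaModEquiv_naturality, Equiv.apply_symm_apply] at h
  rw [yonedaModEquiv_naturality, Equiv.apply_symm_apply]
  exact h

variable {X : ℕ ⥤ S} {F D : SMod S} {a : X ⋙ yonedaMod S ⟶ (Functor.const ℕ).obj F}

lemma exists_extend_colimit (hc : IsColimit (Cocone.mk F a)) (hD : IsCohomological D)
    {P : ObjectProperty S} (hP : ∀ C, P C → vanishing D (C⟦(-1 : ℤ)⟧)) {N : ℕ}
    (hX : ∀ n ≥ N, P.trW (X.map (homOfLE (Nat.le_succ n))))
    (f : (yonedaMod S).obj (X.obj N) ⟶ D) : ∃ g : F ⟶ D, a.app N ≫ g = f :=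
  exists_extend_of_isColimit hc N (fun n hn f => hD.exists_extend hP (hX n hn) f) f

lemma eq_zero_of_colimit (hc : IsColimit (Cocone.mk F a)) (hD : IsCohomological D)
    {P : ObjectProperty S} (hP : P ≤ vanishing D) {N : ℕ}
    (hX : ∀ n ≥ N, P.trW (X.map (homOfLE (Nat.le_succ n))))
    (g : F ⟶ D) (hg : a.app N ≫ g = 0) : g = 0 :=
  eq_zero_of_isColimit hc N (fun n hn f hf => hD.eq_zero_of_trW hP (hX n hn) f hf) g hg

end Vanishing

/-! ### Shifts of modules and of representables -/

section Shift

variable {S : Type u} [Category.{v} S] [Preadditive S]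
  [HasShift S ℤ] [∀ n : ℤ, (shiftFunctor S n).Additive]

instance (n : ℤ) : (modShift S n).Faithful where
  map_injective {F F' f g} h := by
    ext : 1
    exact ((Functor.whiskeringLeft _ _ AddCommGrpCat.{v}).obj
      (shiftFunctor S (-n)).op).map_injective (congrArg
        (fun k : (modShift S n).obj F ⟶ (modShift S n).obj F' => k.hom) h)

instance (n : ℤ) : (modShift S n).Additive where

/-- `Σ^b Σ^a F ≅ Σ^c F` if `a + b = c`. -/
def modShiftAddIso (F : SMod S) (a b c : ℤ) (h : a + b = c) :
    (modShift S b).obj ((modShift S a).obj F) ≅ (modShift S c).obj F :=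
  ObjectProperty.isoMk _ (Functor.isoWhiskerRight
    (NatIso.op (shiftFunctorAdd' S (-b) (-a) (-c) (by lia))) F.obj)

/-- `Σ^0 F ≅ F`. -/
def modShiftZeroIso (F : SMod S) : (modShift S 0).obj F ≅ F :=
  ObjectProperty.isoMk _ (Functor.isoWhiskerRight
    (NatIso.op (shiftFunctorZero' S (-0) (by simp)).symm) F.obj ≪≫ Functor.leftUnitor _)

instance (n : ℤ) (Z : S) : IsIso ((yonedaModEquiv (Z⟦n⟧) ((modShift S n).obj
    ((yonedaMod S).obj Z))).symm ((shiftFunctorCompIsoId S n (-n) (by lia)).hom.app Z)) := by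
  let α := (yonedaModEquiv (Z⟦n⟧) ((modShift S n).obj
    ((yonedaMod S).obj Z))).symm ((shiftFunctorCompIsoId S n (-n) (by lia)).hom.app Z)
  let e := (shiftFunctorCompIsoId S n (-n) (by lia)).app Z
  have (Y : Sᵒᵖ) : IsIso (α.hom.app Y) := by
    rw [ConcreteCategory.isIso_iff_bijective]
    exact e.homToEquiv.bijective.comp
      (Functor.FullyFaithful.ofFullyFaithful (shiftFunctor S (-n))).homEquiv.bijective
  have : IsIso α.hom := NatIso.isIso_of_isIso_app _
  exact (ObjectProperty.isIso_hom_iff _).1 this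

/-- `Σ^n Hom(-, Z) ≅ Hom(-, Z[n])`. -/
noncomputable def modShiftYonedaIso (n : ℤ) (Z : S) :
    (modShift S n).obj ((yonedaMod S).obj Z) ≅ (yonedaMod S).obj (Z⟦n⟧) :=
  (asIso ((yonedaModEquiv (Z⟦n⟧) ((modShift S n).obj ((yonedaMod S).obj Z))).symm
    ((shiftFunctorCompIsoId S n (-n) (add_neg_cancel n)).hom.app Z))).symm

end Shift

lemma shiftsIn_le_iff {S : Type u} [Category.{v} S] [Preadditive S] [HasShift S ℤ]
    (G : S) (I : Set ℤ) (P : ObjectProperty S) :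
    shiftsIn G I ≤ P ↔ ∀ i ∈ I, P (G⟦-i⟧) := by
  refine ⟨fun h i hi => h _ (ObjectProperty.ofObj_apply (fun i : I => G⟦-(i : ℤ)⟧) ⟨i, hi⟩), ?_⟩
  rintro h _ ⟨⟨i, hi⟩⟩
  exact h i hi

/-! ### Generation by `G` from a finite finitistic dimension -/

section Findim

variable {S : Type u} [Category.{v} S] [Preadditive S] [HasZeroObject S] [HasShift S ℤ]
  [∀ n : ℤ, (shiftFunctor S n).Additive] [Pretriangulated S]

lemma generated_of_iso {G : S} {I : Set ℤ} {X Y : S} (e : X ≅ Y) (hY : generated G I Y) :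
    generated G I X :=
  .summand _ _ (Retract.ofIso e) hY

lemma generated_shiftsIn {G : S} {I : Set ℤ} {i : ℤ} (hi : i ∈ I) : generated G I (G⟦-i⟧) :=
  .of _ ((shiftsIn_le_iff G I _).1 le_rfl i hi)

lemma extSummandClosure_unop {P : ObjectProperty Sᵒᵖ} {Q : ObjectProperty S}
    (h : ∀ X, P X → extSummandClosure Q X.unop) {X : Sᵒᵖ} (hX : extSummandClosure P X) :
    extSummandClosure Q X.unop := by
  induction hX with
  | of X hX => exact h X hX
  | ext T hT _ _ h₁ h₃ => exact .ext _ (unop_distinguished T hT) h₃ h₁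
  | summand X Y r _ hY =>
    have r' : Retract X.unop Y.unop := ⟨r.r.unop, r.i.unop, congrArg Quiver.Hom.unop r.retract⟩
    exact .summand _ _ r' hY

/-- Finiteness of the finitistic dimension of the opposite category, spelled out. -/
lemma exists_generated_of_findim_op_lt_top {G : S} (hG : findim (op G) < ⊤) :
    ∃ n : ℕ, ∀ Y : S, (∀ i : ℤ, i ≤ -1 → ∀ f : Y ⟶ G⟦i⟧, f = 0) →
      generated G (Set.Iic (n : ℤ)) Y := by
  simp only [findim, iInf_lt_iff] at hG
  obtain ⟨n, h, -⟩ := hG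
  refine ⟨n, fun Y hY => ?_⟩
  -- Shifts in the opposite category are inverse to those of `S`, so signs flip and `[0, ∞)` becomes
  -- `(-∞, 0]`.
  have e (i : ℤ) : (op G)⟦-i⟧ ≅ op (G⟦i⟧) := (shiftFunctorOpIso S (-i) i (by lia)).app (op G)
  have h₁ : (shiftsIn (op G) (Set.Iic (-1))).rightOrthogonal (op Y) := by
    rintro _ f ⟨⟨i, hi⟩⟩
    have h₂ := hY i hi ((e i).inv ≫ f).unop
    rw [← cancel_epi (e i).inv, comp_zero]
    exact Quiver.Hom.unop_inj h₂
  have h₃ := extSummandClosure_unop (Q := shiftsIn G (Set.Iic 0)) (by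
    rintro _ ⟨⟨i, hi⟩⟩
    exact .summand _ _ (Retract.ofIso ((e i).unop.symm ≪≫ eqToIso (by simp)))
      (generated_shiftsIn (G := G) (I := Set.Iic 0) (i := -i) (by simpa using hi))) (h (op Y) h₁)
  have h₄ := generated_of_iso (((shiftFunctorOpIso S (-(n : ℤ)) n (by lia)).app (op Y)).unop) h₃
  have h₅ := generated_shift G (-(n : ℤ)) (J := Set.Iic (n : ℤ)) (fun i hi => by
    simp only [Set.mem_Iic] at hi ⊢; lia) h₄
  exact generated_of_iso ((shiftFunctorCompIsoId S (n : ℤ) (-n) (by lia)).symm.app Y) h₅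

end Findim

/-! ### First properties of the completion -/

namespace GoodMetric

variable {S : Type u} [Category.{v} S] [Preadditive S] [HasZeroObject S] [HasShift S ℤ]
  [∀ n : ℤ, (shiftFunctor S n).Additive] [Pretriangulated S] {M : GoodMetric S}

lemma completion.isCohomological {F : SMod S} (hF : M.completion F) : IsCohomological F := by
  obtain ⟨X, -, a, ⟨hc⟩⟩ := hF.1
  exact isCohomological_of_isColimit hc (fun n => isCohomological_yonedaMod (X.obj n))

lemma completion.exists_ball_le {F : SMod S} (hF : M.completion F) :
    ∃ j, M.ball j ≤ vanishing F := by
  obtain ⟨j, hj⟩ := hF.2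
  exact ⟨j, fun Z hZ => (vanishing_iff_isZero F Z).2 (hj Z hZ)⟩

lemma Finer.isCauchy {N : GoodMetric S} (h : M.Finer N) {X : ℕ ⥤ S} (hX : M.IsCauchy X) :
    N.IsCauchy X := by
  intro i
  obtain ⟨m, hm⟩ := h i
  obtain ⟨n, hn⟩ := hX m
  exact ⟨n, fun j hj => (ObjectProperty.trW_monotone hm) _ (hn j hj)⟩

lemma yonedaMod_cauchyColimits (Y : S) {F : SMod S} (e : (yonedaMod S).obj Y ≅ F) :
    M.cauchyColimits F := by
  refine ⟨(Functor.const ℕ).obj Y, fun i => ⟨0, fun j _ => ?_⟩,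
    { app := fun _ => e.hom }, ⟨?_⟩⟩
  · have := M.containsZero i
    exact ObjectProperty.trW_of_isIso _ (𝟙 Y)
  · exact
      { desc := fun s => e.inv ≫ s.ι.app 0
        fac := fun s n => by
          dsimp
          rw [e.hom_inv_id_assoc]
          have := s.w (homOfLE (Nat.zero_le n))
          dsimp at this
          exact (this.symm.trans (congrArg (· ≫ s.ι.app n) ((yonedaMod S).map_id Y))).trans
            (Category.id_comp _)
        uniq := fun s m hm => by
          rw [← hm 0]
          exact (e.inv_hom_id_assoc m).symm }

end GoodMetric

/-! ### Part (a): a bounded t-structure makes the completion trivial -/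

section TStructure

variable {S : Type u} [Category.{v} S] [Preadditive S] [HasZeroObject S] [HasShift S ℤ]
  [∀ n : ℤ, (shiftFunctor S n).Additive] [Pretriangulated S]

lemma vanishing_yonedaMod_of_le_of_ge (t : TStructure S) {X Y : S} {m n : ℤ} (hmn : m < n)
    (hX : t.le m X) (hY : t.ge n Y) : vanishing ((yonedaMod S).obj Y) X :=
  (vanishing_yonedaMod_iff _ _).2 fun f => t.zero_of_isLE_of_isGE f m n hmn ⟨hX⟩ ⟨hY⟩

/-- For `i ≤ k` the object `G⟦-i⟧` lies in degrees at most `b + i < c`, and vanishing loci are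
closed under extensions and summands. -/
lemma generated_le_vanishing_of_tStructure (t : TStructure S) {G Y : S} {b c : ℤ}
    (hG : t.le b G) (hY : t.ge c Y) {k : ℤ} (hk : b + k < c) :
    generated G (Set.Iic k) ≤ vanishing ((yonedaMod S).obj Y) := by
  refine (isCohomological_yonedaMod Y).extSummandClosure_le ((shiftsIn_le_iff _ _ _).2 ?_)
  intro i hi
  simp only [Set.mem_Iic] at hi
  exact vanishing_yonedaMod_of_le_of_ge t (by lia) (t.le_shift b (-i) (b + i) (by lia) G hG) hY

/-- The fibre of a sequence at a truncation of a far enough term is killed by the colimit, so that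
the colimit is representable. -/
lemma essImage_of_exists_truncation {X : ℕ ⥤ S} {F : SMod S}
    {a : X ⋙ yonedaMod S ⟶ (Functor.const ℕ).obj F} (hc : IsColimit (Cocone.mk F a))
    {P : ObjectProperty S} {N : ℕ} (hX : ∀ n ≥ N, P.trW (X.map (homOfLE (Nat.le_succ n))))
    (hF : P ≤ vanishing F) {A Y : S} {i : A ⟶ X.obj N} {p : X.obj N ⟶ Y} {q : Y ⟶ A⟦(1 : ℤ)⟧}
    (hT : Triangle.mk i p q ∈ distTriang S) (hA : vanishing F A)
    (hY : ∀ C, P C → vanishing ((yonedaMod S).obj Y) (C⟦(-1 : ℤ)⟧))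
    (hAY : vanishing ((yonedaMod S).obj Y) (A⟦(1 : ℤ)⟧)) : (yonedaMod S).essImage F := by
  have hFc : IsCohomological F :=
    isCohomological_of_isColimit hc (fun n => isCohomological_yonedaMod (X.obj n))
  obtain ⟨Q, hQ⟩ := exists_extend_colimit hc (isCohomological_yonedaMod Y) hY hX
    ((yonedaMod S).map p)
  obtain ⟨σ, hσ⟩ : ∃ σ : (yonedaMod S).obj Y ⟶ F, (yonedaMod S).map p ≫ σ = a.app N :=
    hFc _ hT (a.app N) (hA _)
  refine ⟨Y, ⟨σ, Q, ?_, ?_⟩⟩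
  · rw [← sub_eq_zero]
    -- A map `Y ⟶ Y` killed by `p` factors through `A⟦1⟧`, and there are no nonzero maps `A⟦1⟧ ⟶ Y`.
    have h : (yonedaMod S).map p ≫ (σ ≫ Q - 𝟙 ((yonedaMod S).obj Y)) = 0 := by
      rw [Preadditive.comp_sub, reassoc_of% hσ, Category.comp_id, sub_eq_zero]
      exact hQ
    obtain ⟨y, hy⟩ := isCohomological_yonedaMod Y _ (rot_of_distTriang _ hT) _ h
    exact hy.symm.trans <| (congrArg (_ ≫ ·) (hAY y)).trans comp_zero
  · rw [← sub_eq_zero]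
    refine eq_zero_of_colimit hc hFc hF hX _ ?_
    rw [Preadditive.comp_sub, sub_eq_zero]
    exact ((Category.assoc _ _ _).symm.trans ((congrArg (· ≫ σ) hQ).trans hσ)).trans
      (Category.comp_id _).symm

theorem essImage_eq_completion_of_bounded {G : S} (hG : findim (op G) < ⊤) {M : GoodMetric S}
    (hM : M.IsGood G) (t : TStructure S) (ht : ∀ X : S, t.bounded X) :
    (yonedaMod S).essImage = M.completion := by
  obtain ⟨⟨a₀, ⟨hGa⟩⟩, ⟨b, ⟨hGb⟩⟩⟩ := ht G
  ext F
  constructor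
  · rintro ⟨Y, ⟨e⟩⟩
    refine ⟨GoodMetric.yonedaMod_cauchyColimits Y e, ?_⟩
    obtain ⟨⟨c, ⟨hYc⟩⟩, -⟩ := ht Y
    obtain ⟨m, hm⟩ := hM.1 (b - c + 1).toNat
    refine ⟨m, fun Z hZ => (vanishing_iff_isZero F Z).1 fun f => ?_⟩
    have h := generated_le_vanishing_of_tStructure t hGb hYc (by lia) _ (hm _ hZ) (f ≫ e.inv)
    rw [← cancel_mono e.inv, h, zero_comp]
  · intro hF
    obtain ⟨n₀, hn₀⟩ := exists_generated_of_findim_op_lt_top hG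
    obtain ⟨j, hj⟩ := hF.exists_ball_le
    obtain ⟨k, hk⟩ := hM.2 j
    replace hk : generated G (Set.Iic (-(k : ℤ))) ≤ vanishing F := hk.trans hj
    -- Shifting by `-(k + n₀)` moves `Z` to degrees at most `a₀`, while `G⟦i⟧` with `i < 0` lives in
    -- degrees above `a₀`; so the finitistic dimension applies, and shifting back trades `n₀` for
    -- `-k`.
    have hd : t.le (a₀ - k - n₀) ≤ vanishing F := by
      intro Z hZ
      refine hk _ ?_
      have h₁ : generated G (Set.Iic (n₀ : ℤ)) (Z⟦-((k : ℤ) + n₀)⟧) := by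
        refine hn₀ _ fun i hi f => t.zero_of_isLE_of_isGE f a₀ (a₀ - i) (by lia)
          ⟨t.le_shift (a₀ - k - n₀) _ _ (by lia) _ hZ⟩ ⟨t.ge_shift a₀ _ _ (by lia) _ hGa⟩
      have h₂ := generated_shift G ((k : ℤ) + n₀) (J := Set.Iic (-(k : ℤ))) (fun i hi => by
        simp only [Set.mem_Iic] at hi ⊢; lia) h₁
      exact generated_of_iso
        ((shiftFunctorCompIsoId S (-((k : ℤ) + n₀)) ((k : ℤ) + n₀) (by lia)).symm.app Z) h₂
    obtain ⟨X, hX, a, ⟨hc⟩⟩ := hF.1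
    -- With `d = a₀ - k - n₀`, the summand `k` makes `F` kill the cones; the rest makes the cones
    -- shifted by `-1` orthogonal to degrees above `d`.
    obtain ⟨N, hN⟩ := (GoodMetric.Finer.isCauchy hM.1 hX) (k + (b + 1 - (a₀ - k - n₀)).toNat)
    obtain ⟨A, Y, hA, hY, i, p, q, hT⟩ :=
      t.exists_triangle (X.obj N) (a₀ - k - n₀) (a₀ - k - n₀ + 1) rfl
    refine essImage_of_exists_truncation hc hN (fun C hC => hk _ ?_) hT (hd _ hA)
      (fun C hC => ?_) ?_
    · exact generated_mono G (fun i hi => by simp only [Set.mem_Iic] at hi ⊢; lia) hC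
    · exact generated_le_vanishing_of_tStructure t hGb hY (k := a₀ - k - n₀ - b) (by lia) _
        (generated_shift G (-1) (fun i hi => by simp only [Set.mem_Iic] at hi ⊢; lia) hC)
    · exact vanishing_yonedaMod_of_le_of_ge t (by lia)
        (t.le_shift _ 1 (a₀ - k - n₀ - 1) (by lia) _ hA) hY

end TStructure

/-! ### Transporting vanishing of morphisms along shifts -/

section ShiftHom

variable {S : Type u} [Category.{v} S] [Preadditive S] [HasShift S ℤ]
  [∀ n : ℤ, (shiftFunctor S n).Additive]

lemma hom_modShift_eq_zero {F F' : SMod S} {a b a' b' : ℤ} (k : ℤ) (ha : a + k = a')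
    (hb : b + k = b') (h : ∀ f : (modShift S a').obj F ⟶ (modShift S b').obj F', f = 0)
    (g : (modShift S a).obj F ⟶ (modShift S b).obj F') : g = 0 := by
  apply (modShift S k).map_injective
  have := h ((modShiftAddIso F a k a' ha).inv ≫ (modShift S k).map g ≫
    (modShiftAddIso F' b k b' hb).hom)
  rw [Preadditive.IsIso.comp_left_eq_zero, Preadditive.IsIso.comp_right_eq_zero] at this
  rw [this, Functor.map_zero]

lemma hom_modShift_neg_eq_zero {F F' : SMod S}
    (h : ∀ f : (modShift S 1).obj F ⟶ F', f = 0) (g : F ⟶ (modShift S (-1)).obj F') : g = 0 := by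
  have := hom_modShift_eq_zero (F := F) (F' := F') (a := 0) (b := -1) (a' := 1) (b' := 0) 1
    (by lia) (by lia) (fun f => by
      have := h (f ≫ (modShiftZeroIso F').hom)
      rwa [Preadditive.IsIso.comp_right_eq_zero] at this) ((modShiftZeroIso F).hom ≫ g)
  rwa [Preadditive.IsIso.comp_left_eq_zero] at this

lemma hom_shift_eq_zero {X Y : S} (k : ℤ) {X' Y' : S} (eX : X' ≅ X⟦k⟧) (eY : Y⟦k⟧ ≅ Y')
    (h : ∀ f : X' ⟶ Y', f = 0) (g : X ⟶ Y) : g = 0 := by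
  apply (shiftFunctor S k).map_injective
  have := h (eX.hom ≫ g⟦k⟧' ≫ eY.hom)
  rw [Preadditive.IsIso.comp_left_eq_zero, Preadditive.IsIso.comp_right_eq_zero] at this
  rw [this, Functor.map_zero]

end ShiftHom

/-! ### Triangles and t-structures in the completion -/

namespace GoodMetric

variable {S : Type u} [Category.{v} S] [Preadditive S] [HasZeroObject S] [HasShift S ℤ]
  [∀ n : ℤ, (shiftFunctor S n).Additive] [Pretriangulated S]

variable {M : GoodMetric S}

/-- In a distinguished triangle `A ⟶ B ⟶ C ⟶ ΣA` of the completion with `B ⟶ C` zero and such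
that there are no nonzero morphisms `ΣA ⟶ C`, the object `C` vanishes. -/
lemma IsDistinguished.vanishing_obj₃ {A B C : SMod S} {α : A ⟶ B} {β : B ⟶ C}
    {γ : C ⟶ (modShift S 1).obj A} (h : M.IsDistinguished α β γ) (hβ : β = 0)
    (hAC : ∀ f : (modShift S 1).obj A ⟶ C, f = 0) (Z : S) : vanishing C Z := by
  obtain ⟨hA, hB, hC, T, hT, h₁, h₂, h₃, a, b, c, ⟨ha⟩, ⟨hb⟩, ⟨hc⟩, eα, eβ, -⟩ := h
  obtain ⟨j, hj⟩ := hC.exists_ball_le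
  -- Maps into `Σ⁻¹C` are obstructed by cones shifted by `1` and then by `-1`; each shift costs one
  -- step of the metric.
  obtain ⟨N, hN⟩ := h₁ (j + 2)
  have key₁ (n : ℕ) (hn : n ≥ N) (e : (yonedaMod S).obj ((T.obj n).obj₁⟦(1 : ℤ)⟧) ⟶ C) :
      e = 0 := by
    -- Transpose `e` to a map from the `n`-th term to `Σ⁻¹C`; it extends to `A`, where it must
    -- vanish by `hAC`.
    let f : (yonedaMod S).obj (T.obj n).obj₁ ⟶ (modShift S (-1)).obj C :=
      (yonedaModEquiv (T.obj n).obj₁ ((modShift S (-1)).obj C)).symm (yonedaModEquiv _ C e)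
    obtain ⟨g, hg⟩ := exists_extend_of_isColimit ha n (fun m hm f' =>
      hC.isCohomological.exists_extend_modShift (-1) (fun D hD => hj _
        (M.shift_neg _ _ (M.shift_pos _ _ hD))) (hN m (hn.trans hm)) f') f
    have hf : f = 0 := by
      rw [← hg, hom_modShift_neg_eq_zero hAC g]
      exact comp_zero
    refine (yonedaModEquiv _ C).injective ?_
    let E := yonedaModEquiv (T.obj n).obj₁ ((modShift S (-1)).obj C)
    exact (E.apply_symm_apply (yonedaModEquiv _ C e)).symm.trans (congrArg E hf)
  have key₂ (n : ℕ) (hn : n ≥ N) : c.app n = 0 := by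
    obtain ⟨e, he⟩ := hC.isCohomological _ (rot_of_distTriang _ (hT n)) (c.app n)
      ((eβ n).symm.trans ((congrArg (b.app n ≫ ·) hβ).trans comp_zero))
    rw [← he]
    exact (congrArg (_ ≫ ·) (key₁ n hn e)).trans comp_zero
  intro f
  obtain ⟨n, g, rfl⟩ := exists_factor_of_isColimit hc f
  rw [← (Cocone.mk C c).w (homOfLE (Nat.le_add_left n N))]
  dsimp only
  rw [key₂ _ (Nat.le_add_right N n), comp_zero, comp_zero]

/-- A diagram chase at finite stages: every map into a third vertex dies further along the sequence,
and then exactness of the triangles of `S` gives injectivity and surjectivity on the colimits. -/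
lemma IsDistinguished.isIso_mor₁ {A B C : SMod S} {α : A ⟶ B} {β : B ⟶ C}
    {γ : C ⟶ (modShift S 1).obj A} (h : M.IsDistinguished α β γ) (hC : ∀ Z : S, vanishing C Z) :
    IsIso α := by
  obtain ⟨-, -, -, T, hT, h₁, h₂, h₃, a, b, c, ⟨ha⟩, ⟨hb⟩, ⟨hc⟩, eα, eβ, -⟩ := h
  obtain ⟨a', ha'⟩ : ∃ a' : ∀ n, (yonedaMod S).obj (T.obj n).obj₁ ⟶ A, ∀ n, a' n = a.app n :=
    ⟨fun n => a.app n, fun _ => rfl⟩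
  obtain ⟨b', hb'⟩ : ∃ b' : ∀ n, (yonedaMod S).obj (T.obj n).obj₂ ⟶ B, ∀ n, b' n = b.app n :=
    ⟨fun n => b.app n, fun _ => rfl⟩
  have ea (n : ℕ) : a' n ≫ α = (yonedaMod S).map (T.obj n).mor₁ ≫ b' n := by
    rw [ha', hb']
    exact eα n
  have ha₁ {Z : S} (f : (yonedaMod S).obj Z ⟶ A) :
      ∃ (n : ℕ) (w : Z ⟶ (T.obj n).obj₁), (yonedaMod S).map w ≫ a' n = f := by
    simp only [ha']
    exact exists_map_comp_eq ha f
  have hb₁ {Z : S} (f : (yonedaMod S).obj Z ⟶ B) :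
      ∃ (n : ℕ) (w : Z ⟶ (T.obj n).obj₂), (yonedaMod S).map w ≫ b' n = f := by
    simp only [hb']
    exact exists_map_comp_eq hb f
  have hb₂ {Z : S} {n : ℕ} (w : Z ⟶ (T.obj n).obj₂) (hw : (yonedaMod S).map w ≫ b' n = 0) :
      ∃ (m : ℕ) (h : n ⟶ m), w ≫ (T.map h).hom₂ = 0 := by
    rw [hb'] at hw
    exact exists_comp_map_eq_zero hb w hw
  have hc₂ {Z : S} {n : ℕ} (w : Z ⟶ (T.obj n).obj₃) :
      ∃ (m : ℕ) (h : n ⟶ m), w ≫ (T.map h).hom₃ = 0 :=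
    exists_comp_map_eq_zero hc w (hC Z _)
  have wa {n m : ℕ} (h : n ⟶ m) : (yonedaMod S).map (T.map h).hom₁ ≫ a' m = a' n := by
    rw [ha', ha']
    exact (Cocone.mk A a).w h
  have wb {n m : ℕ} (h : n ⟶ m) : (yonedaMod S).map (T.map h).hom₂ ≫ b' m = b' n := by
    rw [hb', hb']
    exact (Cocone.mk B b).w h
  refine isIso_of_bijective_yonedaMod α fun Z => ⟨fun f g hfg => ?_, fun x => ?_⟩
  · rw [← sub_eq_zero]
    have hfg' : (f - g) ≫ α = 0 := by
      rw [Preadditive.sub_comp, sub_eq_zero]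
      exact hfg
    generalize f - g = f at hfg'
    obtain ⟨n, w, rfl⟩ := ha₁ f
    rw [Category.assoc, ea, ← Functor.map_comp_assoc] at hfg'
    obtain ⟨m, h, hm⟩ := hb₂ _ hfg'
    rw [Category.assoc, (T.map h).comm₁] at hm
    obtain ⟨v, hv⟩ := Triangle.coyoneda_exact₁ _ (hT m) ((w ≫ (T.map h).hom₁)⟦(1 : ℤ)⟧') (by
      rw [← Functor.map_comp, Category.assoc, hm, Functor.map_zero])
    obtain ⟨k, h', hk⟩ := hc₂ v
    have hw : w ≫ (T.map h).hom₁ ≫ (T.map h').hom₁ = 0 := by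
      apply (shiftFunctor S (1 : ℤ)).map_injective
      rw [← Category.assoc, Functor.map_comp, hv, Category.assoc, (T.map h').comm₃,
        reassoc_of% hk, zero_comp, Functor.map_zero]
    rw [← wa h, ← wa h', ← Functor.map_comp_assoc, ← Functor.map_comp_assoc, Category.assoc,
      hw, Functor.map_zero, zero_comp]
  · obtain ⟨n, w, rfl⟩ := hb₁ x
    obtain ⟨m, h, hm⟩ := hc₂ (w ≫ (T.obj n).mor₂)
    obtain ⟨u, hu⟩ := Triangle.coyoneda_exact₂ _ (hT m) (w ≫ (T.map h).hom₂) (by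
      rw [Category.assoc, ← (T.map h).comm₂, ← Category.assoc, hm])
    refine ⟨(yonedaMod S).map u ≫ a' m, ?_⟩
    dsimp only
    rw [Category.assoc, ea, ← wb h, ← Functor.map_comp_assoc, ← Functor.map_comp_assoc, hu]

namespace TStructureOn

variable {X : ObjectProperty (SMod S)} (t : M.TStructureOn X)

lemma aisle_of_iso {F F' : SMod S} (e : F ≅ F') (h : t.aisle F) : t.aisle F' :=
  t.aisle_closedUnderIso.of_iso e h

lemma coaisle_of_iso {F F' : SMod S} (e : F ≅ F') (h : t.coaisle F) : t.coaisle F' :=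
  t.coaisle_closedUnderIso.of_iso e h

lemma aisle_modShift_of_le {F : SMod S} {a b : ℤ} (hab : a ≤ b)
    (h : t.aisle ((modShift S a).obj F)) : t.aisle ((modShift S b).obj F) := by
  induction b, hab using Int.leInduction with
  | base => exact h
  | succ b _ ih =>
    exact t.aisle_shift _ (t.aisle_of_iso (modShiftAddIso F (b + 1) (-1) b (by lia)).symm ih)

lemma coaisle_modShift_of_le {F : SMod S} {a b : ℤ} (hab : b ≤ a)
    (h : t.coaisle ((modShift S a).obj F)) : t.coaisle ((modShift S b).obj F) := by
  induction b, hab using Int.leInductionDown with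
  | base => exact h
  | pred b _ ih =>
    exact t.coaisle_of_iso (modShiftAddIso F b (-1) (b - 1) (by lia)) (t.coaisle_shift _ ih)

lemma aisle_modShift_nat {F : SMod S} (h : t.aisle F) (n : ℕ) :
    t.aisle ((modShift S n).obj F) :=
  t.aisle_modShift_of_le (Int.natCast_nonneg n) (t.aisle_of_iso (modShiftZeroIso F).symm h)

lemma hom_modShift_eq_zero_of_le {F F' : SMod S} {a b c : ℤ} (hb : t.aisle ((modShift S b).obj F))
    (hab : b < a) (hc : t.coaisle ((modShift S c).obj F')) {d : ℤ} (hd : d ≤ c)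
    (f : (modShift S a).obj F ⟶ (modShift S d).obj F') : f = 0 :=
  t.hom_eq_zero f (t.aisle_of_iso (modShiftAddIso F a (-1) (a - 1) (by lia)).symm
    (t.aisle_modShift_of_le (by lia) hb)) (t.coaisle_modShift_of_le hd hc)

/-- The aisle contains the left orthogonal of the coaisle, up to a shift. -/
lemma aisle_of_hom_eq_zero {F : SMod S} (hF : X F)
    (h : ∀ B, t.coaisle B → ∀ f : F ⟶ B, f = 0) : t.aisle F := by
  obtain ⟨A, B, α, β, γ, -, hA, hB, hT⟩ := t.exists_triangle F hF
  -- The truncation map `β` is zero by hypothesis and `ΣA` has no maps to the coaisle, so `B`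
  -- vanishes and `A ≅ F`.
  have hC := hT.vanishing_obj₃ (h B hB β) (fun f => t.hom_eq_zero f (t.aisle_of_iso
    ((modShiftAddIso A 1 (-1) 0 (by lia)).trans (modShiftZeroIso A)).symm
      (t.aisle_shift A hA)) hB)
  have := hT.isIso_mor₁ hC
  exact t.aisle_of_iso (asIso α) (t.aisle_shift A hA)

end TStructureOn

end GoodMetric

/-! ### Part (b): comparison of bounded t-structures -/

namespace GoodMetric

variable {S : Type u} [Category.{v} S] [Preadditive S] [HasZeroObject S] [HasShift S ℤ]
  [∀ n : ℤ, (shiftFunctor S n).Additive] [Pretriangulated S]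

/-- If the colimit of a Cauchy sequence has no morphisms to `G[i]` for `i < s`, then the terms of
the sequence are eventually generated by `G` in bounded above degrees. -/
lemma exists_generated_of_colimit {G : S} {n₀ k : ℕ}
    (hn₀ : ∀ Y : S, (∀ i : ℤ, i ≤ -1 → ∀ f : Y ⟶ G⟦i⟧, f = 0) →
      generated G (Set.Iic (n₀ : ℤ)) Y)
    (hk : generated G (Set.Iic (-(k : ℤ))) ≤ vanishing ((yonedaMod S).obj G))
    {X : ℕ ⥤ S} {F : SMod S} (hX : (ofObject G).IsCauchy X)
    {a : X ⋙ yonedaMod S ⟶ (Functor.const ℕ).obj F} (hc : IsColimit (Cocone.mk F a)) (s : ℕ)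
    (hF : ∀ i : ℤ, i ≤ s - 1 → ∀ f : F ⟶ (yonedaMod S).obj (G⟦i⟧), f = 0) :
    ∃ N, ∀ n ≥ N, generated G (Set.Iic ((n₀ : ℤ) - s)) (X.obj n) := by
  -- The functor of `G` kills `⟨G⟩^(-∞, -k]`; extending maps to `G⟦i⟧` with `i ≤ s - 1` shifts the
  -- cones by `-1 - i`, which this margin absorbs.
  obtain ⟨N, hN⟩ := hX (k + s + 1)
  have hP (i : ℤ) (hi : i ≤ s - 1) (C : S) (hC : (ofObject G).ball (k + s + 1) C) :
      vanishing ((yonedaMod S).obj (G⟦i⟧)) (C⟦(-1 : ℤ)⟧) := by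
    rw [vanishing_yonedaMod_iff]
    have h₁ : generated G (Set.Iic (-(k : ℤ))) (C⟦-1 - i⟧) := generated_shift G _ (fun j hj => by
      simp only [Set.mem_Iic] at hj ⊢; lia) hC
    exact hom_shift_eq_zero (-i) ((shiftFunctorAdd' S (-1) (-i) (-1 - i) (by lia)).app C)
      ((shiftFunctorCompIsoId S i (-i) (by lia)).app G)
      ((vanishing_yonedaMod_iff _ _).1 (hk _ h₁))
  refine ⟨N, fun n hn => ?_⟩
  have hXn (i : ℤ) (hi : i ≤ s - 1) (g : X.obj n ⟶ G⟦i⟧) : g = 0 := by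
    obtain ⟨f, hf⟩ := exists_extend_colimit hc (isCohomological_yonedaMod (G⟦i⟧)) (hP i hi)
      (fun m hm => hN m (hn.trans hm)) ((yonedaMod S).map g)
    apply (yonedaMod S).map_injective
    rw [← hf, hF i hi f, Functor.map_zero]
    exact comp_zero
  have h := generated_shift G (s : ℤ) (J := Set.Iic ((n₀ : ℤ) - s)) (fun j hj => by
      simp only [Set.mem_Iic] at hj ⊢; lia) (hn₀ ((X.obj n)⟦-(s : ℤ)⟧) fun i hi =>
    hom_shift_eq_zero s ((shiftFunctorCompIsoId S (-(s : ℤ)) s (by lia)).symm.app (X.obj n))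
      ((shiftFunctorAdd' S i s (i + s) rfl).symm.app G) (hXn (i + s) (by lia)))
  exact generated_of_iso ((shiftFunctorCompIsoId S (-(s : ℤ)) s (by lia)).symm.app (X.obj n)) h

namespace TStructureOn

variable {M : GoodMetric S} {X : ObjectProperty (SMod S)}

/-- For `i ≤ -q - 1` the object `G⟦-i⟧` lies in `X^{≤ q + i} ⊆ X^{≤ -1}`, which is orthogonal to the
coaisle. -/
lemma generated_le_vanishing (t : M.TStructureOn X) (hX : X ≤ M.completion) {G : S} {q : ℤ}
    (hG : t.aisle ((modShift S q).obj ((yonedaMod S).obj G))) {B : SMod S} (hB : t.coaisle B) :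
    generated G (Set.Iic (-q - 1)) ≤ vanishing B := by
  refine (hX _ (t.coaisle_le _ hB)).isCohomological.extSummandClosure_le
    ((shiftsIn_le_iff _ _ _).2 fun i hi f => ?_)
  simp only [Set.mem_Iic] at hi
  rw [← cancel_epi (modShiftYonedaIso (-i) G).hom, comp_zero,
    ← cancel_mono (modShiftZeroIso B).inv, zero_comp]
  exact t.hom_modShift_eq_zero_of_le hG (by lia)
    (t.coaisle_of_iso (modShiftZeroIso B).symm hB) le_rfl _

lemma exists_aisle_le (hX : X ≤ M.completion) (hS : (yonedaMod S).essImage ≤ X) {G : S}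
    (hG : findim (op G) < ⊤) (hM : M.IsGood G) (t₁ t₂ : M.TStructureOn X) (h₁ : t₁.IsBounded)
    (h₂ : t₂.IsBounded) :
    ∃ m : ℕ, ∀ F, t₁.aisle F → t₂.aisle ((modShift S m).obj F) := by
  obtain ⟨n₀, hn₀⟩ := exists_generated_of_findim_op_lt_top hG
  have hGX : X ((yonedaMod S).obj G) := hS _ ((yonedaMod S).obj_mem_essImage G)
  obtain ⟨-, p, hp⟩ := h₁ _ hGX
  obtain ⟨⟨q, hq⟩, -⟩ := h₂ _ hGX
  obtain ⟨j, hj⟩ := (hX _ hGX).exists_ball_le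
  obtain ⟨k, hk⟩ := hM.2 j
  -- The shift by `p` compensates for the position of `G` in the first t-structure; with `s = n₀ + q
  -- + 1` the bound `n₀ - s` becomes `-q - 1`, as needed for the second.
  refine ⟨p + (n₀ + q + 1), fun F hF => ?_⟩
  have hH := t₁.aisle_le _ (t₁.aisle_modShift_nat hF (p + (n₀ + q + 1)))
  obtain ⟨Y, hY, a, ⟨hc⟩⟩ := (hX _ hH).1
  obtain ⟨N, hN⟩ := exists_generated_of_colimit hn₀ (hk.trans hj)
    (Finer.isCauchy hM.1 hY) hc (n₀ + q + 1) (fun i hi f => by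
      rw [← cancel_mono (modShiftYonedaIso i G).inv, zero_comp]
      -- After this shift the source is `ΣF` and the target is `Σ^d` of `G` with `d ≤ -p`.
      refine hom_modShift_eq_zero (1 - (p + (n₀ + q + 1) : ℕ)) (a' := 1) (by lia) rfl
        (t₁.hom_modShift_eq_zero_of_le (b := 0)
          (t₁.aisle_of_iso (modShiftZeroIso F).symm hF) (by lia) hp (by lia)) _)
  have hH₂ (B : SMod S) (hB : t₂.coaisle B) (n : ℕ) (hn : n ≥ N) :
      vanishing B (Y.obj n) :=
    t₂.generated_le_vanishing hX hq hB _
      (generated_mono G (fun i hi => by simp only [Set.mem_Iic] at hi ⊢; lia) (hN n hn))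
  exact t₂.aisle_of_hom_eq_zero hH fun B hB f => eq_zero_of_isColimit hc N
    (fun n hn g _ => hH₂ B hB (n + 1) (by lia) g) f (hH₂ B hB N le_rfl _)

theorem equivalent_of_isBounded (hX : X ≤ M.completion) (hS : (yonedaMod S).essImage ≤ X) {G : S}
    (hG : findim (op G) < ⊤) (hM : M.IsGood G) (t₁ t₂ : M.TStructureOn X) (h₁ : t₁.IsBounded)
    (h₂ : t₂.IsBounded) : t₁.Equivalent t₂ := by
  obtain ⟨m, hm⟩ := exists_aisle_le hX hS hG hM t₁ t₂ h₁ h₂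
  obtain ⟨m', hm'⟩ := exists_aisle_le hX hS hG hM t₂ t₁ h₂ h₁
  -- The sum serves both inclusions, since aisles are stable under positive shifts.
  refine ⟨m + m', fun F hF => ?_, fun F hF => ?_⟩
  · have h := hm _ (t₁.aisle_modShift_of_le (a := -((m + m' : ℕ) : ℤ)) (b := -(m : ℤ)) (by lia) hF)
    exact t₂.aisle_of_iso ((modShiftAddIso F (-(m : ℤ)) m 0 (by lia)).trans (modShiftZeroIso F)) h
  · exact t₁.aisle_modShift_of_le (by lia) (hm' F hF)

end TStructureOn

end GoodMetric

end TriangulatedCompletion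

open TriangulatedCompletion in
theorem theorem1p5 {S : Type u} [Category.{v} S] [Preadditive S] [HasZeroObject S]
    [HasShift S ℤ] [∀ n : ℤ, (shiftFunctor S n).Additive] [Pretriangulated S] [IsTriangulated S]
    [EssentiallySmall.{w} S] (G : S) (hG : findim (op G) < ⊤)
    (M : GoodMetric S) (hM : M.IsGood G) :
    ((∃ t : TStructure S, ∀ X : S, t.bounded X) →
      (yonedaMod S).essImage = M.completion) ∧
    (∀ X : ObjectProperty (SMod S), M.IsTriangulatedSubcategory X →
      (yonedaMod S).essImage ≤ X →
      ∀ t₁ t₂ : M.TStructureOn X, t₁.IsBounded → t₂.IsBounded → t₁.Equivalent t₂) ∧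
    ((yonedaMod S).essImage ≤ M.completion →
      ∀ t₁ t₂ : M.TStructureOn M.completion,
        t₁.IsBounded → t₂.IsBounded → t₁.Equivalent t₂) := by
  refine ⟨fun ⟨t, ht⟩ => essImage_eq_completion_of_bounded hG hM t ht,
    fun X hX hS t₁ t₂ h₁ h₂ => ?_, fun hS t₁ t₂ h₁ h₂ => ?_⟩
  · exact GoodMetric.TStructureOn.equivalent_of_isBounded hX.le_completion hS hG hM t₁ t₂ h₁ h₂
  · exact GoodMetric.TStructureOn.equivalent_of_isBounded le_rfl hS hG hM t₁ t₂ h₁ h₂
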